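/- Let $T\in(0,\infty)$, let $(\Omega,\mathcal F,\mathbb P)$ be a probability space with a filtration $(\mathcal F_t)_{t\in[0,T)}$, let $\alpha>0$, and let $L=(L_t)_{t\in[0,T)}$ be a real-valued martingale all of whose paths are càdlàg on $[0,T)$. Put $$\mathcal I^\alpha_t L:=\frac{\alpha}{T^\alpha}\int_0^T (T-u)^{\alpha-1}L_{u\wedge t}\,\mathrm du,\qquad t\in[0,T),$$ and, for $q\in[1,\infty]$, $$\|L\|_{\mathbb B^\alpha_{\infty,q}}:=\Big\|\,t\mapsto (T-t)^\alpha\|L_t\|_{L_\infty}\Big\|_{L_q([0,T),\frac{\mathrm dt}{T-t})}\in[0,\infty].$$ For an adapted càdlàg process $Y=(Y_t)_{t\in[0,T)}$ with $Y_0\equiv0$ let $\|Y\|_{\mathrm{BMO}_2([0,T))}\in[0,\infty]$ be the infimum (with $\inf\emptyset:=\infty$) of all $c\in[0,\infty)$ such that for every $t\in[0,T)$ and every stopping time $\rho:\Omega\to[0,t]$ $$\mathbb E\big[|Y_t-Y_{\rho-}|^2\,\big|\,\mathcal F_\rho\big]\le c^2\quad\text{a.s.},$$ where the conditional expectation is the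 extended one for non-negative random variables, $Y_{s-}:=\lim_{r\uparrow s}Y_r$ for $s>0$, and $Y_{0-}:=Y_0$. Then the following inequalities hold in $[0,\infty]$: 1. $\displaystyle\Big\|\sup_{t\in[0,T)}|\mathcal I^\alpha_tL|\Big\|_{L_\infty}\le\frac{\alpha}{T^\alpha}\,\|L\|_{\mathbb B^\alpha_{\infty,1}}$; 2. if $L_0\equiv0$, then $\displaystyle\|\mathcal I^\alpha L\|_{\mathrm{BMO}_2([0,T))}\le 3\,\frac{\sqrt{2\alpha}}{T^\alpha}\,\|L\|_{\mathbb B^\alpha_{\infty,2}}$; 3. $\displaystyle\|L_t\|_{L_\infty}\le\frac1{(T-t)^\alpha}\,\|L\|_{\mathbb B^\alpha_{\infty,\infty}}$ for all $t\in[0,T)$. -/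

import Mathlib

open MeasureTheory ProbabilityTheory Filter Topology
open scoped ENNReal NNReal

namespace RLBesov

/-- A function on the time interval `[0, T)` is càdlàg: right-continuous at every time, with a
finite left limit at every time (at time `0` the condition on the left limit is void). -/
def IsCadlag {T : ℝ} (K : Set.Ico (0 : ℝ) T → ℝ) : Prop :=
  ∀ t, ContinuousWithinAt K (Set.Ici t) t ∧ ∃ l : ℝ, Tendsto K (𝓝[<] t) (𝓝 l)

/-- Lebesgue measure on the time interval `[0, T)`. -/
noncomputable def timeMeasure (T : ℝ) : Measure (Set.Ico (0 : ℝ) T) :=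
  Measure.comap Subtype.val volume

/-- The measure `dt / (T - t)` on the time interval `[0, T)`. -/
noncomputable def weightedTimeMeasure (T : ℝ) : Measure (Set.Ico (0 : ℝ) T) :=
  (timeMeasure T).withDensity fun t => ENNReal.ofReal (1 / (T - (t : ℝ)))

/-- The Riemann-Liouville type operator of order `α ≥ 0`:
`(α / T ^ α) ∫₀ᵀ (T - u) ^ (α - 1) K (u ∧ t) du` for `α > 0`, and `K t` for `α = 0`. -/
noncomputable def riemannLiouville {T : ℝ} (α : ℝ) (K : Set.Ico (0 : ℝ) T → ℝ)
    (t : Set.Ico (0 : ℝ) T) : ℝ :=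
  if α = 0 then K t
  else α / T ^ α * ∫ u, (T - (u : ℝ)) ^ (α - 1) * K (min u t) ∂(timeMeasure T)

/-- The norm `‖L‖_{B^α_{p,q}}`: the `L_q([0, T), dt / (T - t))`-norm of
`t ↦ (T - t) ^ α ‖L_t‖_{L_p}`, with values in `[0, ∞]`. -/
noncomputable def besovNorm {Ω : Type*} [MeasurableSpace Ω] (P : Measure Ω) {T : ℝ}
    (α : ℝ) (p q : ℝ≥0∞) (L : Set.Ico (0 : ℝ) T → Ω → ℝ) : ℝ≥0∞ :=
  eLpNorm (fun t : Set.Ico (0 : ℝ) T =>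
    ENNReal.ofReal ((T - (t : ℝ)) ^ α) * eLpNorm (L t) p P) q (weightedTimeMeasure T)

/-- `c` is an admissible constant in the definition of `‖Y‖_{BMO_p([0, T))}`: for every
`t ∈ [0, T)` and every stopping time `ρ : Ω → [0, t]`, almost surely
`E[|Y_t - Y_{ρ-}| ^ p | F_ρ] ≤ c ^ p`. The conditional expectation is the extended one, of
`[0, ∞]`-valued functions, and `Y_{0-} = Y_0` (this is the convention of `Function.leftLim`). -/
def IsBMOBound {Ω : Type*} [MeasurableSpace Ω] (P : Measure Ω) {T : ℝ}
    (𝓕 : Filtration (Set.Ico (0 : ℝ) T) ‹MeasurableSpace Ω›)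
    (p : ℝ) (Y : Set.Ico (0 : ℝ) T → Ω → ℝ) (c : ℝ≥0) : Prop :=
  ∀ (t : Set.Ico (0 : ℝ) T) (ρ : Ω → Set.Ico (0 : ℝ) T)
    (hρ : IsStoppingTime 𝓕 fun ω => (ρ ω : WithTop (Set.Ico (0 : ℝ) T))),
    (∀ ω, ρ ω ≤ t) →
    ∀ᵐ ω ∂P, (P⁻[fun ω' => ‖Y t ω' - Function.leftLim (fun s => Y s ω') (ρ ω')‖ₑ ^ p |
      hρ.measurableSpace]) ω ≤ (c : ℝ≥0∞) ^ p

/-- The norm `‖Y‖_{BMO_p([0, T))}`: the infimum of the admissible constants `c ∈ [0, ∞)`, which is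
`∞` if there are none. -/
noncomputable def bmoNorm {Ω : Type*} [MeasurableSpace Ω] (P : Measure Ω) {T : ℝ}
    (𝓕 : Filtration (Set.Ico (0 : ℝ) T) ‹MeasurableSpace Ω›)
    (p : ℝ) (Y : Set.Ico (0 : ℝ) T → Ω → ℝ) : ℝ≥0∞ :=
  ⨅ (c : ℝ≥0) (_ : IsBMOBound P 𝓕 p Y c), (c : ℝ≥0∞)

end RLBesov

namespace RLBesov

lemma lintegral_timeMeasure (T : ℝ) (f : ℝ → ℝ≥0∞) :
    ∫⁻ u, f (u : ℝ) ∂timeMeasure T = ∫⁻ u in Set.Ico 0 T, f u :=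
  lintegral_subtype_comap measurableSet_Ico f

instance (T : ℝ) : IsFiniteMeasure (timeMeasure T) := by
  refine ⟨?_⟩
  have h := lintegral_timeMeasure T (fun _ => 1)
  simp only [lintegral_const, one_mul, Measure.restrict_apply_univ, Real.volume_Ico] at h
  rw [h]
  exact ENNReal.ofReal_lt_top

lemma measurable_rpow_sub (T r : ℝ) :
    Measurable fun u : Set.Ico (0 : ℝ) T => (T - (u : ℝ)) ^ r := by
  fun_prop

lemma sub_pos_of_Ico {T : ℝ} (u : Set.Ico (0 : ℝ) T) : 0 < T - (u : ℝ) := sub_pos.2 u.2.2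

lemma integrableOn_rpow_sub {T r : ℝ} (hr : 0 < r) {a : ℝ} (ha : a ≤ T) :
    IntegrableOn (fun v => (T - v) ^ (r - 1)) (Set.Ico a T) := by
  have h : IntervalIntegrable (fun x : ℝ => x ^ (r - 1)) volume (T - a) (T - T) :=
    intervalIntegral.intervalIntegrable_rpow' (by linarith)
  have h2 : IntervalIntegrable (fun v : ℝ => (T - v) ^ (r - 1)) volume a T := by
    simpa using h.comp_sub_left T
  exact ((intervalIntegrable_iff_integrableOn_Ioc_of_le ha).1 h2).congr_set_ae Ico_ae_eq_Ioc

lemma setLIntegral_rpow_sub {T r : ℝ} (hr : 0 < r) {a : ℝ} (ha : a ≤ T) :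
    ∫⁻ v in Set.Ico a T, ENNReal.ofReal ((T - v) ^ (r - 1)) = ENNReal.ofReal ((T - a) ^ r / r) := by
  rw [← ofReal_integral_eq_lintegral_ofReal (integrableOn_rpow_sub hr ha)]
  · rw [integral_Ico_eq_integral_Ioc, ← intervalIntegral.integral_of_le ha,
      intervalIntegral.integral_comp_sub_left (fun x => x ^ (r - 1)) T, sub_self,
      integral_rpow (Or.inl (by linarith)), sub_add_cancel, Real.zero_rpow hr.ne', sub_zero]
  · refine (ae_restrict_iff' measurableSet_Ico).2 (ae_of_all _ fun v hv => ?_)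
    exact Real.rpow_nonneg (sub_nonneg.2 hv.2.le) _

lemma setLIntegral_Ici_rpow_sub {T r : ℝ} (hr : 0 < r) (u : Set.Ico (0 : ℝ) T) :
    ∫⁻ v in Set.Ici u, ENNReal.ofReal ((T - (v : ℝ)) ^ (r - 1)) ∂timeMeasure T
      = ENNReal.ofReal ((T - (u : ℝ)) ^ r / r) := by
  rw [← setLIntegral_rpow_sub hr u.2.2.le, ← lintegral_indicator measurableSet_Ici,
    ← lintegral_indicator measurableSet_Ico]
  have h := lintegral_timeMeasure T
    ((Set.Ici (u : ℝ)).indicator fun v => ENNReal.ofReal ((T - v) ^ (r - 1)))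
  rw [← lintegral_indicator measurableSet_Ico] at h
  have hs : Set.Ico (u : ℝ) T = Set.Ico 0 T ∩ Set.Ici (u : ℝ) := by
    ext v
    exact ⟨fun h => ⟨⟨u.2.1.trans h.1, h.2⟩, h.1⟩, fun h => ⟨h.2, h.1.2⟩⟩
  rw [hs, ← Set.indicator_indicator]
  exact h

lemma integrable_rpow_sub {T r : ℝ} (hT : 0 < T) (hr : 0 < r) :
    Integrable (fun u : Set.Ico (0 : ℝ) T => (T - (u : ℝ)) ^ (r - 1)) (timeMeasure T) := by
  refine ⟨(measurable_rpow_sub T _).aestronglyMeasurable, ?_⟩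
  rw [hasFiniteIntegral_iff_ofReal
    (ae_of_all _ fun u => Real.rpow_nonneg (sub_pos_of_Ico u).le _)]
  rw [lintegral_timeMeasure T fun u => ENNReal.ofReal ((T - u) ^ (r - 1)),
    setLIntegral_rpow_sub hr hT.le]
  exact ENNReal.ofReal_lt_top

lemma lintegral_weightedTimeMeasure {T : ℝ} (f : Set.Ico (0 : ℝ) T → ℝ≥0∞) (hf : Measurable f) :
    ∫⁻ u, f u ∂weightedTimeMeasure T
      = ∫⁻ u, ENNReal.ofReal (1 / (T - (u : ℝ))) * f u ∂timeMeasure T :=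
  lintegral_withDensity_eq_lintegral_mul _ (by fun_prop) hf

lemma ofReal_rpow_weight {T : ℝ} (r : ℝ) (u : Set.Ico (0 : ℝ) T) :
    ENNReal.ofReal (1 / (T - (u : ℝ))) * ENNReal.ofReal ((T - (u : ℝ)) ^ r)
      = ENNReal.ofReal ((T - (u : ℝ)) ^ (r - 1)) := by
  have h := sub_pos_of_Ico u
  rw [← ENNReal.ofReal_mul (by positivity), Real.rpow_sub_one h.ne', one_div, div_eq_inv_mul]

variable {Ω : Type*} [MeasurableSpace Ω] {P : Measure Ω}

lemma besovNorm_one {T : ℝ} (α : ℝ) {L : Set.Ico (0 : ℝ) T → Ω → ℝ}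
    (hN : Measurable fun u => eLpNorm (L u) ∞ P) :
    besovNorm P α ∞ 1 L
      = ∫⁻ u, ENNReal.ofReal ((T - (u : ℝ)) ^ (α - 1)) * eLpNorm (L u) ∞ P ∂timeMeasure T := by
  rw [besovNorm, eLpNorm_one_eq_lintegral_enorm]
  simp only [enorm_eq_self]
  rw [lintegral_weightedTimeMeasure _ (by fun_prop)]
  simp only [← mul_assoc, ofReal_rpow_weight]

lemma besovNorm_two_sq {T : ℝ} (α : ℝ) {L : Set.Ico (0 : ℝ) T → Ω → ℝ}
    (hN : Measurable fun u => eLpNorm (L u) ∞ P) :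
    besovNorm P α ∞ 2 L ^ 2
      = ∫⁻ u, ENNReal.ofReal ((T - (u : ℝ)) ^ (2 * α - 1)) * eLpNorm (L u) ∞ P ^ 2
          ∂timeMeasure T := by
  have h := eLpNorm_nnreal_pow_eq_lintegral (μ := weightedTimeMeasure T) (p := 2)
    (f := fun t : Set.Ico (0 : ℝ) T =>
      ENNReal.ofReal ((T - (t : ℝ)) ^ α) * eLpNorm (L t) ∞ P) (by norm_num)
  simp only [enorm_eq_self, NNReal.coe_ofNat, ENNReal.coe_ofNat, ENNReal.rpow_ofNat, mul_pow] at h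
  rw [besovNorm, h, lintegral_weightedTimeMeasure _ (by fun_prop)]
  refine lintegral_congr fun u => ?_
  have hu := sub_pos_of_Ico u
  rw [← mul_assoc, ← ENNReal.ofReal_pow (by positivity), ← Real.rpow_mul_natCast hu.le,
    Nat.cast_ofNat, mul_comm α, ofReal_rpow_weight]

/-- The double integral of a function of the earlier time, against a power weight. -/
lemma lintegral_lintegral_min_le {T r : ℝ} (hr : 0 < r) (g : Set.Ico (0 : ℝ) T → ℝ≥0∞)
    (hg : Measurable g) :
    ∫⁻ u, ∫⁻ v, ENNReal.ofReal ((T - (u : ℝ)) ^ (r - 1)) *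
        (ENNReal.ofReal ((T - (v : ℝ)) ^ (r - 1)) * g (min u v)) ∂timeMeasure T ∂timeMeasure T
      ≤ 2 * (ENNReal.ofReal (1 / r) *
          ∫⁻ u, ENNReal.ofReal ((T - (u : ℝ)) ^ (2 * r - 1)) * g u ∂timeMeasure T) := by
  set w : Set.Ico (0 : ℝ) T → ℝ≥0∞ := fun u => ENNReal.ofReal ((T - (u : ℝ)) ^ (r - 1)) with hw
  have hwm : Measurable w := by fun_prop
  let F : Set.Ico (0 : ℝ) T → Set.Ico (0 : ℝ) T → ℝ≥0∞ := fun u v =>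
    w u * g u * (Set.Ici u).indicator w v
  have hFm : Measurable (Function.uncurry F) := by
    have hs : MeasurableSet {p : Set.Ico (0 : ℝ) T × Set.Ico (0 : ℝ) T | p.1 ≤ p.2} :=
      measurableSet_le measurable_fst measurable_snd
    exact ((hwm.comp measurable_fst).mul (hg.comp measurable_fst)).mul
      ((hwm.comp measurable_snd).indicator hs)
  have hF : ∫⁻ u, ∫⁻ v, F u v ∂timeMeasure T ∂timeMeasure T = ENNReal.ofReal (1 / r) *
      ∫⁻ u, ENNReal.ofReal ((T - (u : ℝ)) ^ (2 * r - 1)) * g u ∂timeMeasure T := by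
    rw [← lintegral_const_mul _ (by fun_prop)]
    refine lintegral_congr fun u => ?_
    have hu := sub_pos_of_Ico u
    simp only [F]
    rw [lintegral_const_mul _ (hwm.indicator measurableSet_Ici),
      lintegral_indicator measurableSet_Ici, setLIntegral_Ici_rpow_sub hr, mul_right_comm,
      ← mul_assoc, hw, ← ENNReal.ofReal_mul (by positivity), ← ENNReal.ofReal_mul (by positivity)]
    congr 2
    rw [show 2 * r - 1 = r - 1 + r by ring, Real.rpow_add hu]
    ring
  calc _ ≤ ∫⁻ u, ∫⁻ v, (F u v + F v u) ∂timeMeasure T ∂timeMeasure T := by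
        refine lintegral_mono fun u => lintegral_mono fun v => ?_
        rcases le_total u v with h | h
        · refine le_trans (le_of_eq ?_) le_self_add
          simp only [F, Set.indicator_of_mem (Set.mem_Ici.2 h), min_eq_left h, hw]
          ring
        · refine le_trans (le_of_eq ?_) le_add_self
          simp only [F, Set.indicator_of_mem (Set.mem_Ici.2 h), min_eq_right h, hw]
          ring
    _ = ∫⁻ u, ∫⁻ v, F u v ∂timeMeasure T ∂timeMeasure T
        + ∫⁻ u, ∫⁻ v, F v u ∂timeMeasure T ∂timeMeasure T := by
        rw [← lintegral_add_left (μ := timeMeasure T)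
          (f := fun u => ∫⁻ v, F u v ∂timeMeasure T) hFm.lintegral_prod_right']
        refine lintegral_congr fun u => ?_
        exact lintegral_add_left (hFm.comp measurable_prodMk_left) _
    _ = _ := by
        rw [lintegral_lintegral_swap (f := fun u v => F v u)
          (hFm.comp measurable_swap).aemeasurable, ← hF, two_mul]

lemma ae_timeMeasure_of_ae_weightedTimeMeasure {T : ℝ} {p : Set.Ico (0 : ℝ) T → Prop}
    (hp : ∀ᵐ u ∂weightedTimeMeasure T, p u) : ∀ᵐ u ∂timeMeasure T, p u := by
  have h := (ae_withDensity_iff (μ := timeMeasure T)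
    (f := fun t : Set.Ico (0 : ℝ) T => ENNReal.ofReal (1 / (T - (t : ℝ)))) (by fun_prop)).1 hp
  refine h.mono fun u hu => hu ?_
  have := sub_pos_of_Ico u
  simpa using this

/-- A property that holds almost everywhere on `[0, T)` holds at times arbitrarily close to the
right of any given time. -/
lemma frequently_nhdsGT_of_ae {T : ℝ} {p : Set.Ico (0 : ℝ) T → Prop}
    (hp : ∀ᵐ u ∂timeMeasure T, p u) (t : Set.Ico (0 : ℝ) T) : ∃ᶠ u in 𝓝[>] t, p u := by
  intro hc
  obtain ⟨b, hb, hsub⟩ := (mem_nhdsGT_iff_exists_Ioo_subset (a := t)).1 hc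
  have h0 : timeMeasure T (Set.Ioo t b) = 0 :=
    measure_mono_null (fun u hu => by simpa using hsub hu) (ae_iff.1 hp)
  have h1 : timeMeasure T (Set.Ioo t b) = volume (Set.Ioo (t : ℝ) b) := by
    rw [timeMeasure, (MeasurableEmbedding.subtype_coe measurableSet_Ico).comap_apply]
    congr 1
    ext x
    constructor
    · rintro ⟨y, hy, rfl⟩
      exact hy
    · intro hx
      exact ⟨⟨x, t.2.1.trans hx.1.le, hx.2.trans b.2.2⟩, hx, rfl⟩
  rw [h1, Real.volume_Ioo, ENNReal.ofReal_eq_zero] at h0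
  have : (t : ℝ) < b := hb
  linarith

end RLBesov

namespace RLBesov

lemma tendsto_of_abs_sub_le {f : ℕ → ℝ} {a : ℝ} (h : ∀ n : ℕ, |f n - a| ≤ 1 / ((n : ℝ) + 1)) :
    Tendsto f atTop (𝓝 a) :=
  tendsto_iff_norm_sub_tendsto_zero.2
    (squeeze_zero (fun _ => norm_nonneg _) h tendsto_one_div_add_atTop_nhds_zero_nat)

lemma measurable_comp_of_countable {ι S β : Type*} [Countable ι] [MeasurableSpace ι]
    [MeasurableSingletonClass ι] [MeasurableSpace S] [MeasurableSpace β] {Y : ι → S → β}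
    (hY : ∀ j, Measurable (Y j)) {k : S → ι} (hk : Measurable k) :
    Measurable fun x => Y (k x) x := by
  have h : Measurable fun p : ι × S => Y p.1 p.2 := measurable_from_prod_countable_right hY
  exact h.comp (hk.prodMk measurable_id')

section Measurability

variable {S : Type*} [MeasurableSpace S] {T : ℝ} {X : Set.Ico (0 : ℝ) T → S → ℝ}

/-- The left limit of a process at a bounded random time is measurable with respect to the
information up to the bound. -/
lemma measurable_leftLim_comp
    (hlim : ∀ x t, ∃ l : ℝ, Tendsto (fun s => X s x) (𝓝[<] t) (𝓝 l)) (u : Set.Ico (0 : ℝ) T)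
    (hX : ∀ s ≤ u, Measurable (X s)) {R : S → Set.Ico (0 : ℝ) T} (hR : Measurable R)
    (hRu : ∀ x, R x ≤ u) :
    Measurable fun x => Function.leftLim (fun s => X s x) (R x) := by
  let g : ℕ → ℕ → Set.Ico (0 : ℝ) T := fun n k =>
    ⟨min (u : ℝ) (((k - 1 : ℕ) : ℝ) / ((n : ℝ) + 1)), le_min u.2.1 (by positivity),
      (min_le_left _ _).trans_lt u.2.2⟩
  have hgu : ∀ n k, g n k ≤ u := fun n k => min_le_left (u : ℝ) _
  let k : ℕ → S → ℕ := fun n x => ⌈((n : ℝ) + 1) * (R x : ℝ)⌉₊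
  have hk : ∀ n, Measurable (k n) := fun n =>
    Nat.measurable_ceil.comp ((measurable_subtype_coe.comp hR).const_mul _)
  refine measurable_of_tendsto_metrizable (f := fun n x => X (g n (k n x)) x) (fun n => ?_) ?_
  · exact measurable_comp_of_countable (fun j => hX (g n j) (hgu n j)) (hk n)
  rw [tendsto_pi_nhds]
  intro x
  rcases (R x).2.1.eq_or_lt with h0 | h0
  · have hbot : IsBot (R x) := fun s => by
      rw [← Subtype.coe_le_coe, ← h0]
      exact s.2.1
    have hg0 : ∀ n, g n (k n x) = R x := fun n => by
      refine le_antisymm ?_ (hbot _)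
      rw [← Subtype.coe_le_coe]
      refine (min_le_right _ _).trans ?_
      simp [k, ← h0]
    rw [leftLim_eq_of_isBot hbot]
    simp [hg0]
  · refine (tendsto_leftLim_of_tendsto (hlim x (R x))).comp ?_
    have hRx : (R x : ℝ) ≤ u := hRu x
    have key : ∀ n, ((g n (k n x) : Set.Ico (0 : ℝ) T) : ℝ) < R x ∧
        (R x : ℝ) - 1 / ((n : ℝ) + 1) ≤ g n (k n x) := fun n => by
      have hn : (0 : ℝ) < (n : ℝ) + 1 := by positivity
      have hpos : 0 < k n x := Nat.ceil_pos.2 (mul_pos hn h0)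
      have hcast : ((k n x - 1 : ℕ) : ℝ) = (k n x : ℝ) - 1 := by
        rw [Nat.cast_sub hpos, Nat.cast_one]
      have h1 : (k n x : ℝ) < ((n : ℝ) + 1) * R x + 1 := Nat.ceil_lt_add_one (by positivity)
      have h2 : ((n : ℝ) + 1) * R x ≤ k n x := Nat.le_ceil _
      have h3 : ((k n x - 1 : ℕ) : ℝ) / ((n : ℝ) + 1) < R x := by
        rw [hcast, div_lt_iff₀ hn]
        linarith
      refine ⟨(min_le_right _ _).trans_lt h3, le_min ?_ ?_⟩
      · have : 0 < 1 / ((n : ℝ) + 1) := by positivity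
        linarith
      · rw [hcast, le_div_iff₀ hn, sub_mul, div_mul_cancel₀ _ hn.ne']
        linarith
    refine tendsto_nhdsWithin_iff.2 ⟨?_, Eventually.of_forall fun n => (key n).1⟩
    refine tendsto_subtype_rng.2 (tendsto_of_abs_sub_le fun n => ?_)
    rw [abs_sub_comm, abs_of_nonneg (sub_nonneg.2 (key n).1.le)]
    linarith [(key n).2]

/-- A right-continuous process is jointly measurable. -/
lemma measurable_uncurry_min
    (hright : ∀ x t, ContinuousWithinAt (fun s => X s x) (Set.Ici t) t) (t : Set.Ico (0 : ℝ) T)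
    (hX : ∀ s, Measurable (X s)) :
    Measurable fun p : S × Set.Ico (0 : ℝ) T => X (min p.2 t) p.1 := by
  let g : ℕ → ℕ → Set.Ico (0 : ℝ) T := fun n k =>
    ⟨min (t : ℝ) ((k : ℝ) / ((n : ℝ) + 1)), le_min t.2.1 (by positivity),
      (min_le_left _ _).trans_lt t.2.2⟩
  let k : ℕ → Set.Ico (0 : ℝ) T → ℕ := fun n u => ⌈((n : ℝ) + 1) * (u : ℝ)⌉₊
  have hk : ∀ n, Measurable (k n) := fun n =>
    Nat.measurable_ceil.comp (measurable_subtype_coe.const_mul _)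
  refine measurable_of_tendsto_metrizable
    (f := fun n (p : S × Set.Ico (0 : ℝ) T) => X (g n (k n p.2)) p.1) (fun n => ?_) ?_
  · exact measurable_comp_of_countable (fun j => (hX (g n j)).comp measurable_fst)
      ((hk n).comp measurable_snd)
  rw [tendsto_pi_nhds]
  rintro ⟨x, u⟩
  refine (hright x (min u t)).tendsto.comp ?_
  have key : ∀ n, ((min u t : Set.Ico (0 : ℝ) T) : ℝ) ≤ g n (k n u) ∧
      (g n (k n u) : ℝ) ≤ (min u t : Set.Ico (0 : ℝ) T) + 1 / ((n : ℝ) + 1) := fun n => by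
    have hn : (0 : ℝ) < (n : ℝ) + 1 := by positivity
    have hu := u.2.1
    have h1 : (k n u : ℝ) < ((n : ℝ) + 1) * u + 1 := Nat.ceil_lt_add_one (by positivity)
    have h2 : ((n : ℝ) + 1) * u ≤ k n u := Nat.le_ceil _
    have h3 : (u : ℝ) ≤ (k n u : ℝ) / ((n : ℝ) + 1) := by
      rw [le_div_iff₀ hn]
      linarith
    have h4 : (k n u : ℝ) / ((n : ℝ) + 1) ≤ u + 1 / ((n : ℝ) + 1) := by
      rw [div_le_iff₀ hn, add_mul, div_mul_cancel₀ _ hn.ne']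
      linarith
    have h5 : 0 < 1 / ((n : ℝ) + 1) := by positivity
    refine ⟨le_min (Subtype.coe_le_coe.2 (min_le_right u t))
      ((Subtype.coe_le_coe.2 (min_le_left u t)).trans h3), ?_⟩
    rcases le_total u t with h | h
    · rw [min_eq_left h]
      exact (min_le_right _ _).trans h4
    · rw [min_eq_right h]
      exact (min_le_left _ _).trans (by linarith)
  refine tendsto_nhdsWithin_iff.2 ⟨?_, Eventually.of_forall fun n => (key n).1⟩
  refine tendsto_subtype_rng.2 (tendsto_of_abs_sub_le fun n => ?_)
  rw [abs_of_nonneg (sub_nonneg.2 (key n).1)]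
  linarith [(key n).2]

end Measurability

section Path

variable {T : ℝ} {K : Set.Ico (0 : ℝ) T → ℝ}

lemma IsCadlag.measurable_min (hK : IsCadlag K) (t : Set.Ico (0 : ℝ) T) :
    Measurable fun u => K (min u t) :=
  (measurable_uncurry_min (S := Unit) (X := fun s _ => K s) (fun _ s => (hK s).1) t
    fun _ => measurable_const).comp (measurable_prodMk_left (x := ()))

lemma IsCadlag.tendsto_leftLim (hK : IsCadlag K) (t : Set.Ico (0 : ℝ) T) :
    Tendsto K (𝓝[<] t) (𝓝 (Function.leftLim K t)) :=
  tendsto_leftLim_of_tendsto (hK t).2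

lemma enorm_leftLim_le (hK : IsCadlag K) {r : Set.Ico (0 : ℝ) T} {C : ℝ≥0∞}
    (hC : ∀ s ≤ r, ‖K s‖ₑ ≤ C) : ‖Function.leftLim K r‖ₑ ≤ C := by
  rcases eq_or_neBot (𝓝[<] r) with h | h
  · rw [leftLim_eq_of_eq_bot K h]
    exact hC r le_rfl
  · refine le_of_tendsto (hK.tendsto_leftLim r).enorm ?_
    filter_upwards [self_mem_nhdsWithin] with s hs using hC s (le_of_lt hs)

/-- The path `K` stopped at `t`, minus the same path stopped just before `r ≤ t`. -/
noncomputable def stoppedIncrement (K : Set.Ico (0 : ℝ) T → ℝ) (r t u : Set.Ico (0 : ℝ) T) : ℝ :=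
  if r ≤ u then K (min u t) - Function.leftLim K r else 0

lemma enorm_stoppedIncrement_le (hK : IsCadlag K) {r t u : Set.Ico (0 : ℝ) T} (hrt : r ≤ t)
    {C : ℝ≥0∞} (hC : ∀ s ≤ min u t, ‖K s‖ₑ ≤ C) : ‖stoppedIncrement K r t u‖ₑ ≤ 2 * C := by
  rw [stoppedIncrement]
  split_ifs with h
  · rw [two_mul]
    exact enorm_sub_le.trans (add_le_add (hC _ le_rfl)
      (enorm_leftLim_le hK fun s hs => hC s (hs.trans (le_min h hrt))))
  · simp

lemma riemannLiouville_sub_leftLim {α : ℝ} (hT : 0 < T) (hα : 0 < α) (hK : IsCadlag K)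
    {r t : Set.Ico (0 : ℝ) T} (hrt : r ≤ t) {C : ℝ} (hC : ∀ s ≤ t, ‖K s‖ ≤ C) :
    riemannLiouville α K t - Function.leftLim (riemannLiouville α K) r =
      α / T ^ α * ∫ u, (T - (u : ℝ)) ^ (α - 1) * stoppedIncrement K r t u ∂timeMeasure T := by
  have hRL : riemannLiouville α K = fun t => α / T ^ α *
      ∫ u, (T - (u : ℝ)) ^ (α - 1) * K (min u t) ∂timeMeasure T := by
    ext t
    simp [riemannLiouville, hα.ne']
  have hw := integrable_rpow_sub hT hα
  have hw0 : ∀ u : Set.Ico (0 : ℝ) T, 0 ≤ (T - (u : ℝ)) ^ (α - 1) := fun u =>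
    Real.rpow_nonneg (sub_pos_of_Ico u).le _
  have hCl : ‖Function.leftLim K r‖ ≤ C := by
    have hC0 : 0 ≤ C := (norm_nonneg _).trans (hC t le_rfl)
    have h := enorm_leftLim_le hK (r := r) (C := ENNReal.ofReal C) fun s hs => by
      rw [← ofReal_norm]
      exact ENNReal.ofReal_le_ofReal (hC s (hs.trans hrt))
    rw [← ofReal_norm] at h
    exact (ENNReal.ofReal_le_ofReal_iff hC0).1 h
  let M : Set.Ico (0 : ℝ) T → ℝ := fun u => if r ≤ u then Function.leftLim K r else K (min u t)
  have hM : Measurable M := Measurable.ite measurableSet_Ici measurable_const (hK.measurable_min t)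
  have hMC : ∀ u, ‖M u‖ ≤ C := fun u => by
    simp only [M]
    split_ifs
    · exact hCl
    · exact hC _ (min_le_right _ _)
  have hleft : Function.leftLim (riemannLiouville α K) r = α / T ^ α *
      ∫ u, (T - (u : ℝ)) ^ (α - 1) * M u ∂timeMeasure T := by
    rcases eq_or_neBot (𝓝[<] r) with h | h
    · rw [leftLim_eq_of_eq_bot _ h, hRL]
      refine congrArg _ (integral_congr_ae (ae_of_all _ fun u => ?_))
      simp only [M, leftLim_eq_of_eq_bot _ h]
      split_ifs with hu
      · rw [min_eq_right hu]
      · have hu' := (not_le.1 hu).le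
        rw [min_eq_left hu', min_eq_left (hu'.trans hrt)]
    · refine leftLim_eq_of_tendsto ?_
      rw [hRL]
      refine Tendsto.const_mul _ (tendsto_integral_filter_of_dominated_convergence
        (fun u => (T - (u : ℝ)) ^ (α - 1) * C) ?_ ?_ (hw.mul_const C) ?_)
      · exact Eventually.of_forall fun s =>
          ((measurable_rpow_sub T _).mul (hK.measurable_min s)).aestronglyMeasurable
      · filter_upwards [self_mem_nhdsWithin] with s hs
        refine ae_of_all _ fun u => ?_
        rw [norm_mul, Real.norm_of_nonneg (hw0 u)]
        exact mul_le_mul_of_nonneg_left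
          (hC _ ((min_le_right _ _).trans ((le_of_lt hs).trans hrt))) (hw0 u)
      · refine ae_of_all _ fun u => Tendsto.const_mul _ ?_
        simp only [M]
        split_ifs with hu
        · refine (hK.tendsto_leftLim r).congr' ?_
          filter_upwards [self_mem_nhdsWithin] with s hs
          rw [min_eq_right ((le_of_lt hs).trans hu)]
        · have hu' := not_le.1 hu
          refine tendsto_const_nhds.congr' ?_
          filter_upwards [Ioo_mem_nhdsLT hu'] with s hs
          rw [min_eq_left hs.1.le, min_eq_left (hu'.le.trans hrt)]
  have hint : ∀ f : Set.Ico (0 : ℝ) T → ℝ, Measurable f → (∀ u, ‖f u‖ ≤ C) →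
      Integrable (fun u : Set.Ico (0 : ℝ) T => (T - (u : ℝ)) ^ (α - 1) * f u) (timeMeasure T) :=
    fun f hf hfC => hw.mul_bdd hf.aestronglyMeasurable (ae_of_all _ hfC)
  rw [hleft, hRL, ← mul_sub, ← integral_sub
    (hint _ (hK.measurable_min t) fun u => hC _ (min_le_right _ _)) (hint M hM hMC)]
  refine congrArg _ (integral_congr_ae (ae_of_all _ fun u => ?_))
  simp only [← mul_sub]
  congr 1
  simp only [M, stoppedIncrement]
  split_ifs <;> simp

end Path

section Martingale

variable {Ω : Type*} [MeasurableSpace Ω] {P : Measure Ω} {T : ℝ}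
  {𝓕 : Filtration (Set.Ico (0 : ℝ) T) ‹MeasurableSpace Ω›} {L : Set.Ico (0 : ℝ) T → Ω → ℝ}

lemma monotone_eLpNorm (hL : Martingale L 𝓕 P) {p : ℝ≥0∞} (hp : 1 ≤ p) :
    Monotone fun t => eLpNorm (L t) p P := fun s t hst => by
  simp only
  rw [← eLpNorm_congr_ae (hL.condExp_ae_eq hst)]
  exact eLpNorm_condExp_le_eLpNorm _ hp

lemma Dense.frequently_nhdsGT {X : Type*} [LinearOrder X] [TopologicalSpace X] [OrderTopology X]
    [DenselyOrdered X] [NoMaxOrder X] {S : Set X} (hS : Dense S) (a : X) :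
    ∃ᶠ x in 𝓝[>] a, x ∈ S := by
  intro hc
  obtain ⟨b, hb, hsub⟩ := mem_nhdsGT_iff_exists_Ioo_subset.1 hc
  obtain ⟨x, hx, hx'⟩ := hS.exists_between hb
  exact hsub hx' hx

/-- A right-continuous martingale is almost surely dominated, at all times up to `u`
simultaneously, by the `L_∞`-norm at time `u`. -/
lemma ae_forall_enorm_le (hL : Martingale L 𝓕 P)
    (hright : ∀ ω t, ContinuousWithinAt (fun s => L s ω) (Set.Ici t) t) :
    ∀ᵐ ω ∂P, ∀ u, ∀ s ≤ u, ‖L s ω‖ₑ ≤ eLpNorm (L u) ∞ P := by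
  have hmono := monotone_eLpNorm hL (p := ∞) le_top
  obtain ⟨S, hSc, hSd⟩ := TopologicalSpace.exists_countable_dense (Set.Ico (0 : ℝ) T)
  have hD := hmono.countable_not_continuousAt
  have hae : ∀ᵐ ω ∂P, ∀ u ∈ S ∪ {u | ¬ContinuousAt (fun t => eLpNorm (L t) ∞ P) u},
      ‖L u ω‖ₑ ≤ eLpNorm (L u) ∞ P :=
    (ae_ball_iff (hSc.union hD)).2 fun u _ => by
      simpa only [eLpNorm_exponent_top] using enorm_ae_le_eLpNormEssSup (L u) P
  filter_upwards [hae] with ω hω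
  have hself : ∀ u, ‖L u ω‖ₑ ≤ eLpNorm (L u) ∞ P := fun u => by
    by_cases hu : ContinuousAt (fun t => eLpNorm (L t) ∞ P) u
    · exact le_of_tendsto_of_tendsto_of_frequently
        (((hright ω u).mono Set.Ioi_subset_Ici_self).enorm)
        (hu.tendsto.mono_left nhdsWithin_le_nhds)
        ((Dense.frequently_nhdsGT hSd u).mono fun r hr => hω r (Or.inl hr))
    · exact hω u (Or.inr hu)
  exact fun u s hs => (hself s).trans (hmono hs)

lemma integral_mul_sub_eq_zero [IsFiniteMeasure P] (hL : Martingale L 𝓕 P)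
    {u v : Set.Ico (0 : ℝ) T} (huv : u ≤ v) {Z : Ω → ℝ} (hZ : StronglyMeasurable[𝓕 u] Z) (C : ℝ)
    (hC : ∀ᵐ ω ∂P, ‖Z ω‖ ≤ C) : ∫ ω, Z ω * (L v ω - L u ω) ∂P = 0 := by
  have h1 : P[Z * (L v - L u) | 𝓕 u] =ᵐ[P] Z * P[L v - L u | 𝓕 u] :=
    condExp_stronglyMeasurable_mul_of_bound (𝓕.le u) hZ
      ((hL.integrable v).sub (hL.integrable u)) C hC
  have h2 : P[L v - L u | 𝓕 u] =ᵐ[P] 0 := by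
    refine (condExp_sub (hL.integrable v) (hL.integrable u) _).trans ?_
    filter_upwards [hL.condExp_ae_eq huv, hL.condExp_ae_eq (le_refl u)] with ω h3 h4
    simp [h3, h4]
  change ∫ ω, (Z * (L v - L u)) ω ∂P = 0
  rw [← integral_condExp (𝓕.le u)]
  refine integral_eq_zero_of_ae ?_
  filter_upwards [h1, h2] with ω h3 h4
  simp [h3, h4]

end Martingale

end RLBesov

namespace RLBesov

lemma ae_condLExp_le_of_forall_setLIntegral_le {Ω : Type*} {m mΩ : MeasurableSpace Ω}
    {P : Measure Ω} [IsFiniteMeasure P] (hm : m ≤ mΩ) (f : Ω → ℝ≥0∞) (c : ℝ≥0∞)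
    (h : ∀ A, MeasurableSet[m] A → ∫⁻ ω in A, f ω ∂P ≤ c * P A) : ∀ᵐ ω ∂P, P⁻[f | m] ω ≤ c := by
  refine ae_of_ae_trim hm (ae_le_of_forall_setLIntegral_le_of_sigmaFinite (μ := P.trim hm)
    (g := fun _ => c) (measurable_condLExp m P f) fun A hA _ => ?_)
  rw [setLIntegral_condLExp_trim hm P f hA, setLIntegral_const, trim_measurableSet_eq hm hA]
  exact h A hA

variable {Ω : Type*} [MeasurableSpace Ω] {P : Measure Ω} {T : ℝ}
  {𝓕 : Filtration (Set.Ico (0 : ℝ) T) ‹MeasurableSpace Ω›} {L : Set.Ico (0 : ℝ) T → Ω → ℝ}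
  {ρ : Ω → Set.Ico (0 : ℝ) T} {t : Set.Ico (0 : ℝ) T}

lemma norm_stoppedIncrement_le {K : Set.Ico (0 : ℝ) T → ℝ} (hK : IsCadlag K)
    {r t : Set.Ico (0 : ℝ) T} (hrt : r ≤ t) {C : ℝ} (hC : ∀ s ≤ t, ‖K s‖ ≤ C)
    (u : Set.Ico (0 : ℝ) T) : ‖stoppedIncrement K r t u‖ ≤ 2 * C := by
  have hC0 : 0 ≤ C := (norm_nonneg _).trans (hC t le_rfl)
  have h := enorm_stoppedIncrement_le hK hrt (u := u) (C := ENNReal.ofReal C) fun s hs => by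
    rw [← ofReal_norm]
    exact ENNReal.ofReal_le_ofReal (hC s (hs.trans (min_le_right _ _)))
  rw [← ofReal_norm, ← ENNReal.ofReal_ofNat, ← ENNReal.ofReal_mul (by norm_num)] at h
  exact (ENNReal.ofReal_le_ofReal_iff (by positivity)).1 h

lemma measurableSet_le_of_isStoppingTime
    (hρ : IsStoppingTime 𝓕 fun ω => (ρ ω : WithTop (Set.Ico (0 : ℝ) T))) (i : Set.Ico (0 : ℝ) T) :
    MeasurableSet[𝓕 i] {ω | ρ ω ≤ i} := by
  simpa only [WithTop.coe_le_coe] using hρ i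

lemma measurable_of_isStoppingTime
    (hρ : IsStoppingTime 𝓕 fun ω => (ρ ω : WithTop (Set.Ico (0 : ℝ) T))) : Measurable ρ :=
  measurable_of_Iic fun i => 𝓕.le i _ (measurableSet_le_of_isStoppingTime hρ i)

lemma measurable_min_of_isStoppingTime
    (hρ : IsStoppingTime 𝓕 fun ω => (ρ ω : WithTop (Set.Ico (0 : ℝ) T))) (u : Set.Ico (0 : ℝ) T) :
    Measurable[𝓕 u] fun ω => min (ρ ω) u := by
  refine measurable_of_Iic (δ := Ω) (mδ := 𝓕 u) fun i => ?_
  rcases le_total u i with h | h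
  · convert @MeasurableSet.univ _ (𝓕 u)
    ext ω
    simp [h]
  · rcases h.eq_or_lt with rfl | h
    · convert @MeasurableSet.univ _ (𝓕 i)
      ext ω
      simp
    · convert 𝓕.mono h.le _ (measurableSet_le_of_isStoppingTime hρ i)
      ext ω
      simp [h]

lemma measurable_stoppedIncrement
    (hρ : IsStoppingTime 𝓕 fun ω => (ρ ω : WithTop (Set.Ico (0 : ℝ) T))) (hρt : ∀ ω, ρ ω ≤ t)
    (hL : StronglyAdapted 𝓕 L) (hc : ∀ ω, IsCadlag fun t => L t ω) :
    Measurable fun p : Ω × Set.Ico (0 : ℝ) T =>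
      stoppedIncrement (fun s => L s p.1) (ρ p.1) t p.2 := by
  have hρm := measurable_of_isStoppingTime hρ
  have hX : ∀ s, Measurable (L s) := fun s =>
    (hL s).measurable.mono (𝓕.le s) le_rfl
  have h1 := measurable_uncurry_min (X := L) (fun ω t => (hc ω t).1) t hX
  have h2 := measurable_leftLim_comp (X := L) (fun ω t => (hc ω t).2) t (fun s _ => hX s) hρm hρt
  exact Measurable.ite (measurableSet_le (hρm.comp measurable_fst) measurable_snd)
    (h1.sub (h2.comp measurable_fst)) measurable_const

/-- Restricted to an event that is known at the random time, the increment of the process after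
that time is known at the end of the increment. -/
lemma stronglyMeasurable_indicator_stoppedIncrement
    (hρ : IsStoppingTime 𝓕 fun ω => (ρ ω : WithTop (Set.Ico (0 : ℝ) T))) (hρt : ∀ ω, ρ ω ≤ t)
    (hL : StronglyAdapted 𝓕 L) (hc : ∀ ω, IsCadlag fun t => L t ω) {A : Set Ω}
    (hA : MeasurableSet[hρ.measurableSpace] A) (u : Set.Ico (0 : ℝ) T) :
    StronglyMeasurable[𝓕 (min u t)]
      (A.indicator fun ω => stoppedIncrement (fun s => L s ω) (ρ ω) t u) := by
  have hX : ∀ s ≤ min u t, Measurable[𝓕 (min u t)] (L s) := fun s hs =>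
    (hL s).measurable.mono (𝓕.mono hs) le_rfl
  have h2 := @measurable_leftLim_comp Ω (𝓕 (min u t)) T L (fun ω t => (hc ω t).2) (min u t) hX _
    (measurable_min_of_isStoppingTime hρ (min u t)) fun ω => min_le_right _ _
  have hA' : MeasurableSet[𝓕 (min u t)] (A ∩ {ω | ρ ω ≤ min u t}) := by
    simpa only [WithTop.coe_le_coe] using hA.2 (min u t)
  have h3 := (((hX _ le_rfl).sub h2).indicator hA').stronglyMeasurable
  convert h3 using 1
  ext ω
  by_cases h : ω ∈ A
  · by_cases hu : ρ ω ≤ u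
    · have hu' : ρ ω ≤ min u t := le_min hu (hρt ω)
      have hm : ω ∈ A ∩ {ω | ρ ω ≤ min u t} := ⟨h, hu'⟩
      rw [Set.indicator_of_mem h, Set.indicator_of_mem hm, stoppedIncrement, if_pos hu]
      simp only [Pi.sub_apply, min_eq_left hu']
    · have hm : ω ∉ A ∩ {ω | ρ ω ≤ min u t} := fun hm => hu (hm.2.trans (min_le_left _ _))
      rw [Set.indicator_of_mem h, Set.indicator_of_notMem hm, stoppedIncrement, if_neg hu]
  · have hm : ω ∉ A ∩ {ω | ρ ω ≤ min u t} := fun hm => h hm.1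
    rw [Set.indicator_of_notMem h, Set.indicator_of_notMem hm]

/-- Increments of a bounded martingale after a stopping time are orthogonal. -/
lemma setIntegral_stoppedIncrement_mul [IsFiniteMeasure P]
    (hρ : IsStoppingTime 𝓕 fun ω => (ρ ω : WithTop (Set.Ico (0 : ℝ) T))) (hρt : ∀ ω, ρ ω ≤ t)
    (hL : Martingale L 𝓕 P) (hc : ∀ ω, IsCadlag fun t => L t ω) {A : Set Ω}
    (hA : MeasurableSet[hρ.measurableSpace] A) {C : ℝ} (hC : ∀ᵐ ω ∂P, ∀ s ≤ t, ‖L s ω‖ ≤ C)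
    {u v : Set.Ico (0 : ℝ) T} (huv : u ≤ v) :
    ∫ ω in A, stoppedIncrement (fun s => L s ω) (ρ ω) t u *
        stoppedIncrement (fun s => L s ω) (ρ ω) t v ∂P =
      ∫ ω in A, stoppedIncrement (fun s => L s ω) (ρ ω) t u *
        stoppedIncrement (fun s => L s ω) (ρ ω) t u ∂P := by
  set D : Set.Ico (0 : ℝ) T → Ω → ℝ := fun u ω =>
    stoppedIncrement (fun s => L s ω) (ρ ω) t u with hD
  have hDm : ∀ u, Measurable (D u) := fun u =>
    (measurable_stoppedIncrement hρ hρt hL.1 hc).comp measurable_prodMk_right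
  have hDC : ∀ u, ∀ᵐ ω ∂P, ‖D u ω‖ ≤ 2 * C := fun u => by
    filter_upwards [hC] with ω hω using norm_stoppedIncrement_le (hc ω) (hρt ω) hω u
  have hDi : ∀ u v, Integrable (fun ω => D u ω * D v ω) P := fun u v =>
    (Integrable.of_bound (hDm u).aestronglyMeasurable _ (hDC u)).mul_bdd
      (hDm v).aestronglyMeasurable (hDC v)
  have hAm : MeasurableSet A := hρ.measurableSpace_le A hA
  change ∫ ω in A, D u ω * D v ω ∂P = ∫ ω in A, D u ω * D u ω ∂P
  rw [← sub_eq_zero, ← integral_sub (hDi u v).integrableOn (hDi u u).integrableOn,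
    ← integral_indicator hAm, ← integral_mul_sub_eq_zero hL (min_le_min_right t huv)
      (stronglyMeasurable_indicator_stoppedIncrement hρ hρt hL.1 hc hA u) (2 * C) ?_]
  · refine integral_congr_ae (ae_of_all _ fun ω => ?_)
    by_cases h : ω ∈ A
    · simp only [Set.indicator_of_mem h, hD, ← mul_sub]
      by_cases hu : ρ ω ≤ u
      · simp [stoppedIncrement, hu, hu.trans huv]
      · simp [stoppedIncrement, hu]
    · simp [h]
  · filter_upwards [hDC u] with ω hω
    refine le_trans ?_ hω
    exact norm_indicator_le_norm_self _ _

lemma enorm_setIntegral_stoppedIncrement_le [IsFiniteMeasure P]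
    (hρ : IsStoppingTime 𝓕 fun ω => (ρ ω : WithTop (Set.Ico (0 : ℝ) T))) (hρt : ∀ ω, ρ ω ≤ t)
    (hL : Martingale L 𝓕 P) (hc : ∀ ω, IsCadlag fun t => L t ω) {A : Set Ω}
    (hA : MeasurableSet[hρ.measurableSpace] A) {C : ℝ} (hC : ∀ᵐ ω ∂P, ∀ s ≤ t, ‖L s ω‖ ≤ C)
    (u v : Set.Ico (0 : ℝ) T) :
    ‖∫ ω in A, stoppedIncrement (fun s => L s ω) (ρ ω) t u *
        stoppedIncrement (fun s => L s ω) (ρ ω) t v ∂P‖ₑ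
      ≤ eLpNorm (L (min u v)) ∞ P ^ 2 * (4 * P A) := by
  wlog huv : u ≤ v generalizing u v
  · simpa only [mul_comm, min_comm] using this v u (le_of_not_ge huv)
  rw [setIntegral_stoppedIncrement_mul hρ hρt hL hc hA hC huv, min_eq_left huv]
  refine (enorm_integral_le_lintegral_enorm _).trans ?_
  calc _ ≤ ∫⁻ _ in A, eLpNorm (L u) ∞ P ^ 2 * 4 ∂P := by
        refine lintegral_mono_ae (ae_restrict_of_ae ?_)
        filter_upwards [ae_forall_enorm_le hL fun ω t => (hc ω t).1] with ω hω
        have h := enorm_stoppedIncrement_le (hc ω) (hρt ω) fun s hs =>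
          hω u s (hs.trans (min_le_left u t))
        rw [enorm_mul]
        refine (mul_le_mul' h h).trans (le_of_eq ?_)
        ring
    _ = _ := by rw [setLIntegral_const, mul_assoc]

/-- The conditional second moment of the increment of the transformed martingale after a stopping
time, integrated over an event that is known at that time. -/
lemma setLIntegral_enorm_integral_stoppedIncrement_sq_le [IsFiniteMeasure P] (hT : 0 < T)
    {α : ℝ} (hα : 0 < α)
    (hρ : IsStoppingTime 𝓕 fun ω => (ρ ω : WithTop (Set.Ico (0 : ℝ) T))) (hρt : ∀ ω, ρ ω ≤ t)
    (hL : Martingale L 𝓕 P) (hc : ∀ ω, IsCadlag fun t => L t ω) {A : Set Ω}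
    (hA : MeasurableSet[hρ.measurableSpace] A) {C : ℝ} (hC : ∀ᵐ ω ∂P, ∀ s ≤ t, ‖L s ω‖ ≤ C) :
    ∫⁻ ω in A, ‖∫ u, (T - (u : ℝ)) ^ (α - 1) *
        stoppedIncrement (fun s => L s ω) (ρ ω) t u ∂timeMeasure T‖ₑ ^ 2 ∂P
      ≤ ENNReal.ofReal (8 / α) * besovNorm P α ∞ 2 L ^ 2 * P A := by
  set w : Set.Ico (0 : ℝ) T → ℝ := fun u => (T - (u : ℝ)) ^ (α - 1) with hw
  set D : Ω → Set.Ico (0 : ℝ) T → ℝ := fun ω u =>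
    stoppedIncrement (fun s => L s ω) (ρ ω) t u with hD
  set τ := timeMeasure T
  have hw0 : ∀ u, 0 ≤ w u := fun u => Real.rpow_nonneg (sub_pos_of_Ico u).le _
  have hwm : Measurable w := measurable_rpow_sub T _
  have hwi : Integrable w τ := integrable_rpow_sub hT hα
  have hNm : Measurable fun u => eLpNorm (L u) ∞ P := (monotone_eLpNorm hL le_top).measurable
  have hDm : Measurable fun p : Ω × Set.Ico (0 : ℝ) T => D p.1 p.2 :=
    measurable_stoppedIncrement hρ hρt hL.1 hc
  have hDC : ∀ᵐ ω ∂P, ∀ u, ‖D ω u‖ ≤ 2 * C := by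
    filter_upwards [hC] with ω hω using norm_stoppedIncrement_le (hc ω) (hρt ω) hω
  let H : Ω → Set.Ico (0 : ℝ) T × Set.Ico (0 : ℝ) T → ℝ := fun ω p =>
    (w p.1 * D ω p.1) * (w p.2 * D ω p.2)
  have hHi : Integrable (Function.uncurry H) ((P.restrict A).prod (τ.prod τ)) := by
    have h1 : Integrable (fun q : Ω × (Set.Ico (0 : ℝ) T × Set.Ico (0 : ℝ) T) =>
        ((2 * C) * (2 * C)) * (w q.2.1 * w q.2.2)) ((P.restrict A).prod (τ.prod τ)) :=
      Integrable.mul_prod (integrable_const ((2 * C) * (2 * C))) (hwi.mul_prod hwi)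
    refine h1.mono' ?_ ?_
    · refine Measurable.aestronglyMeasurable ?_
      have m1 : Measurable fun q : Ω × (Set.Ico (0 : ℝ) T × Set.Ico (0 : ℝ) T) => (q.1, q.2.1) := by
        fun_prop
      have m2 : Measurable fun q : Ω × (Set.Ico (0 : ℝ) T × Set.Ico (0 : ℝ) T) => (q.1, q.2.2) := by
        fun_prop
      exact ((hwm.comp (measurable_fst.comp measurable_snd)).mul (hDm.comp m1)).mul
        ((hwm.comp (measurable_snd.comp measurable_snd)).mul (hDm.comp m2))
    · filter_upwards [Measure.quasiMeasurePreserving_fst.ae (ae_restrict_of_ae (s := A) hDC)]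
        with q hq
      have hC0 : 0 ≤ 2 * C := (norm_nonneg _).trans (hq q.2.1)
      simp only [Function.uncurry, H, norm_mul, Real.norm_of_nonneg (hw0 _)]
      calc w q.2.1 * ‖D q.1 q.2.1‖ * (w q.2.2 * ‖D q.1 q.2.2‖)
          ≤ w q.2.1 * (2 * C) * (w q.2.2 * (2 * C)) := by
            have h := fun u => mul_le_mul_of_nonneg_left (hq u) (hw0 u)
            exact mul_le_mul (h _) (h _) (mul_nonneg (hw0 _) (norm_nonneg _))
              (mul_nonneg (hw0 _) hC0)
        _ = _ := by ring
  have hsq : ∀ ω, ∫ p, H ω p ∂τ.prod τ = (∫ u, w u * D ω u ∂τ) * ∫ u, w u * D ω u ∂τ := fun ω =>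
    integral_prod_mul (fun u => w u * D ω u) fun u => w u * D ω u
  calc ∫⁻ ω in A, ‖∫ u, w u * D ω u ∂τ‖ₑ ^ 2 ∂P
      = ∫⁻ ω in A, ENNReal.ofReal (∫ p, H ω p ∂τ.prod τ) ∂P := by
        refine lintegral_congr fun ω => ?_
        rw [hsq, sq, ← enorm_mul, Real.enorm_of_nonneg (mul_self_nonneg _)]
    _ = ENNReal.ofReal (∫ ω in A, ∫ p, H ω p ∂τ.prod τ ∂P) := by
        refine (ofReal_integral_eq_lintegral_ofReal hHi.integral_prod_left
          (ae_of_all _ fun ω => ?_)).symm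
        change 0 ≤ ∫ p, H ω p ∂τ.prod τ
        rw [hsq]
        exact mul_self_nonneg _
    _ = ENNReal.ofReal (∫ p, ∫ ω in A, H ω p ∂P ∂τ.prod τ) := by
        rw [integral_integral_swap hHi]
    _ ≤ ∫⁻ p, ‖∫ ω in A, H ω p ∂P‖ₑ ∂τ.prod τ :=
        (Real.ofReal_le_enorm _).trans (enorm_integral_le_lintegral_enorm _)
    _ ≤ ∫⁻ p, ENNReal.ofReal (w p.1) * (ENNReal.ofReal (w p.2) *
          (eLpNorm (L (min p.1 p.2)) ∞ P ^ 2 * (4 * P A))) ∂τ.prod τ := by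
        refine lintegral_mono fun p => ?_
        have h : ∫ ω in A, H ω p ∂P = w p.1 * (w p.2 * ∫ ω in A, D ω p.1 * D ω p.2 ∂P) := by
          rw [← integral_const_mul, ← integral_const_mul]
          refine integral_congr_ae (ae_of_all _ fun ω => ?_)
          simp only [H]
          ring
        simp only
        rw [h, enorm_mul, enorm_mul, Real.enorm_of_nonneg (hw0 _), Real.enorm_of_nonneg (hw0 _)]
        gcongr
        exact enorm_setIntegral_stoppedIncrement_le hρ hρt hL hc hA hC p.1 p.2
    _ = ∫⁻ u, ∫⁻ v, ENNReal.ofReal (w u) * (ENNReal.ofReal (w v) *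
          (eLpNorm (L (min u v)) ∞ P ^ 2 * (4 * P A))) ∂τ ∂τ := by
        refine lintegral_prod _ (Measurable.aemeasurable ?_)
        have m1 : Measurable fun p : Set.Ico (0 : ℝ) T × Set.Ico (0 : ℝ) T =>
            eLpNorm (L (min p.1 p.2)) ∞ P := hNm.comp (measurable_fst.min measurable_snd)
        exact (hwm.comp measurable_fst).ennreal_ofReal.mul
          ((hwm.comp measurable_snd).ennreal_ofReal.mul ((m1.pow_const 2).mul_const _))
    _ ≤ _ := lintegral_lintegral_min_le hα (fun u => eLpNorm (L u) ∞ P ^ 2 * (4 * P A))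
        ((hNm.pow_const 2).mul_const _)
    _ = _ := by
        simp only [← mul_assoc]
        rw [lintegral_mul_const _ (by fun_prop), lintegral_mul_const _ (by fun_prop),
          besovNorm_two_sq α hNm, show (8 : ℝ) / α = 2 * 4 * (1 / α) by ring,
          ENNReal.ofReal_mul (by norm_num), ENNReal.ofReal_mul (by norm_num)]
        simp only [ENNReal.ofReal_ofNat]
        ring

end RLBesov

namespace RLBesov

variable {Ω : Type*} [MeasurableSpace Ω] {P : Measure Ω} {T : ℝ}
  {𝓕 : Filtration (Set.Ico (0 : ℝ) T) ‹MeasurableSpace Ω›} {L : Set.Ico (0 : ℝ) T → Ω → ℝ}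

lemma enorm_riemannLiouville_le {α : ℝ} (hT : 0 < T) (hα : 0 < α) (K : Set.Ico (0 : ℝ) T → ℝ)
    {N : Set.Ico (0 : ℝ) T → ℝ≥0∞} (hN : ∀ u, ∀ s ≤ u, ‖K s‖ₑ ≤ N u) (t : Set.Ico (0 : ℝ) T) :
    ‖riemannLiouville α K t‖ₑ ≤ ENNReal.ofReal (α / T ^ α) *
      ∫⁻ u, ENNReal.ofReal ((T - (u : ℝ)) ^ (α - 1)) * N u ∂timeMeasure T := by
  rw [riemannLiouville, if_neg hα.ne', enorm_mul, Real.enorm_of_nonneg (by positivity)]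
  gcongr
  refine (enorm_integral_le_lintegral_enorm _).trans (lintegral_mono fun u => ?_)
  rw [enorm_mul, Real.enorm_of_nonneg (Real.rpow_nonneg (sub_pos_of_Ico u).le _)]
  gcongr
  exact hN u _ (min_le_left _ _)

lemma eLpNorm_iSup_riemannLiouville_le {α : ℝ} (hT : 0 < T) (hα : 0 < α) (hL : Martingale L 𝓕 P)
    (hc : ∀ ω, IsCadlag fun t => L t ω) :
    eLpNorm (fun ω => ⨆ t, ‖riemannLiouville α (fun s => L s ω) t‖ₑ) ∞ P ≤
      ENNReal.ofReal (α / T ^ α) * besovNorm P α ∞ 1 L := by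
  rw [besovNorm_one α (monotone_eLpNorm hL le_top).measurable, eLpNorm_exponent_top]
  refine essSup_le_of_ae_le _ ?_
  filter_upwards [ae_forall_enorm_le hL fun ω t => (hc ω t).1] with ω hω
  rw [enorm_eq_self]
  exact iSup_le fun t => enorm_riemannLiouville_le hT hα _ hω t

lemma eLpNorm_le_besovNorm_top {α : ℝ} (hα : 0 < α) (hL : Martingale L 𝓕 P)
    (t : Set.Ico (0 : ℝ) T) :
    eLpNorm (L t) ∞ P ≤ ENNReal.ofReal (1 / (T - (t : ℝ)) ^ α) * besovNorm P α ∞ ∞ L := by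
  have hpos := Real.rpow_pos_of_pos (sub_pos_of_Ico t) α
  have hmono := monotone_eLpNorm hL (p := ∞) le_top
  have hae : ∀ᵐ u : Set.Ico (0 : ℝ) T ∂timeMeasure T,
      ENNReal.ofReal ((T - (u : ℝ)) ^ α) * eLpNorm (L u) ∞ P ≤ besovNorm P α ∞ ∞ L := by
    refine ae_timeMeasure_of_ae_weightedTimeMeasure ?_
    simpa only [besovNorm, eLpNorm_exponent_top, enorm_eq_self] using
      enorm_ae_le_eLpNormEssSup (fun u : Set.Ico (0 : ℝ) T =>
        ENNReal.ofReal ((T - (u : ℝ)) ^ α) * eLpNorm (L u) ∞ P) (weightedTimeMeasure T)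
  have hcont : Tendsto (fun u : Set.Ico (0 : ℝ) T =>
      ENNReal.ofReal ((T - (u : ℝ)) ^ α) * eLpNorm (L t) ∞ P) (𝓝[>] t)
      (𝓝 (ENNReal.ofReal ((T - (t : ℝ)) ^ α) * eLpNorm (L t) ∞ P)) := by
    refine ENNReal.Tendsto.mul_const (ENNReal.tendsto_ofReal ?_)
      (Or.inl (ENNReal.ofReal_pos.2 hpos).ne')
    have hcts : Continuous fun u : Set.Ico (0 : ℝ) T => (T - (u : ℝ)) ^ α :=
      (continuous_const.sub continuous_subtype_val).rpow_const fun u =>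
        Or.inr hα.le
    exact hcts.continuousAt.tendsto.mono_left nhdsWithin_le_nhds
  have hle : ENNReal.ofReal ((T - (t : ℝ)) ^ α) * eLpNorm (L t) ∞ P ≤ besovNorm P α ∞ ∞ L := by
    refine le_of_tendsto_of_frequently hcont
      (((frequently_nhdsGT_of_ae hae t).and_eventually self_mem_nhdsWithin).mono fun u hu => ?_)
    refine le_trans ?_ hu.1
    gcongr
    exact hmono (le_of_lt hu.2)
  calc eLpNorm (L t) ∞ P
      = ENNReal.ofReal (1 / (T - (t : ℝ)) ^ α) *
          (ENNReal.ofReal ((T - (t : ℝ)) ^ α) * eLpNorm (L t) ∞ P) := by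
        rw [← mul_assoc, ← ENNReal.ofReal_mul (by positivity), one_div_mul_cancel hpos.ne',
          ENNReal.ofReal_one, one_mul]
    _ ≤ _ := by gcongr

lemma eLpNorm_ne_top_of_besovNorm_two_ne_top {α : ℝ} (hL : Martingale L 𝓕 P)
    (hB : besovNorm P α ∞ 2 L ≠ ∞) (t : Set.Ico (0 : ℝ) T) : eLpNorm (L t) ∞ P ≠ ∞ := by
  have hmono := monotone_eLpNorm hL (p := ∞) le_top
  have hNm : Measurable fun u => eLpNorm (L u) ∞ P := hmono.measurable
  have h := ENNReal.pow_ne_top (n := 2) hB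
  rw [besovNorm_two_sq α hNm] at h
  obtain ⟨u, hu, htu⟩ := ((frequently_nhdsGT_of_ae (ae_lt_top (by fun_prop) h) t).and_eventually
    self_mem_nhdsWithin).exists
  have hu0 : ENNReal.ofReal ((T - (u : ℝ)) ^ (2 * α - 1)) ≠ 0 :=
    (ENNReal.ofReal_pos.2 (Real.rpow_pos_of_pos (sub_pos_of_Ico u) _)).ne'
  have hfin := ENNReal.lt_top_of_mul_ne_top_right hu.ne hu0
  have hu' : eLpNorm (L u) ∞ P < ∞ := by
    by_contra hcon
    rw [not_lt_top_iff.1 hcon] at hfin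
    simp at hfin
  exact ((hmono (le_of_lt htu)).trans_lt hu').ne

lemma ae_condLExp_riemannLiouville_le [IsFiniteMeasure P] {α : ℝ} (hT : 0 < T) (hα : 0 < α)
    (hL : Martingale L 𝓕 P) (hc : ∀ ω, IsCadlag fun t => L t ω) {t : Set.Ico (0 : ℝ) T}
    (hfin : eLpNorm (L t) ∞ P ≠ ∞) {ρ : Ω → Set.Ico (0 : ℝ) T}
    (hρ : IsStoppingTime 𝓕 fun ω => (ρ ω : WithTop (Set.Ico (0 : ℝ) T))) (hρt : ∀ ω, ρ ω ≤ t) :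
    ∀ᵐ ω ∂P, (P⁻[fun ω' => ‖riemannLiouville α (fun s => L s ω') t -
        Function.leftLim (riemannLiouville α fun s => L s ω') (ρ ω')‖ₑ ^ 2 |
      hρ.measurableSpace]) ω
      ≤ (ENNReal.ofReal (2 * (√(2 * α) / T ^ α)) * besovNorm P α ∞ 2 L) ^ 2 := by
  have hC : ∀ᵐ ω ∂P, ∀ s ≤ t, ‖L s ω‖ ≤ (eLpNorm (L t) ∞ P).toReal := by
    filter_upwards [ae_forall_enorm_le hL fun ω t => (hc ω t).1] with ω hω s hs
    rw [← toReal_enorm]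
    exact ENNReal.toReal_mono hfin (hω t s hs)
  refine ae_condLExp_le_of_forall_setLIntegral_le hρ.measurableSpace_le _ _ fun A hA => ?_
  calc _ = ∫⁻ ω in A, ENNReal.ofReal (α / T ^ α) ^ 2 *
        ‖∫ u, (T - (u : ℝ)) ^ (α - 1) *
          stoppedIncrement (fun s => L s ω) (ρ ω) t u ∂timeMeasure T‖ₑ ^ 2 ∂P := by
        refine lintegral_congr_ae (ae_restrict_of_ae ?_)
        filter_upwards [hC] with ω hω
        rw [riemannLiouville_sub_leftLim hT hα (hc ω) (hρt ω) hω, enorm_mul, mul_pow,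
          Real.enorm_of_nonneg (by positivity)]
    _ = ENNReal.ofReal (α / T ^ α) ^ 2 * ∫⁻ ω in A, ‖∫ u, (T - (u : ℝ)) ^ (α - 1) *
          stoppedIncrement (fun s => L s ω) (ρ ω) t u ∂timeMeasure T‖ₑ ^ 2 ∂P :=
        lintegral_const_mul' _ _ (ENNReal.pow_ne_top ENNReal.ofReal_ne_top)
    _ ≤ ENNReal.ofReal (α / T ^ α) ^ 2 *
          (ENNReal.ofReal (8 / α) * besovNorm P α ∞ 2 L ^ 2 * P A) := by
        gcongr
        exact setLIntegral_enorm_integral_stoppedIncrement_sq_le hT hα hρ hρt hL hc hA hC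
    _ = _ := by
        have hTα := Real.rpow_pos_of_pos hT α
        rw [mul_pow, ← mul_assoc, ← mul_assoc, ← ENNReal.ofReal_pow (by positivity),
          ← ENNReal.ofReal_pow (by positivity), ← ENNReal.ofReal_mul (by positivity)]
        congr 3
        rw [mul_pow, div_pow, div_pow, Real.sq_sqrt (by positivity)]
        field_simp
        ring

lemma bmoNorm_riemannLiouville_le [IsFiniteMeasure P] {α : ℝ} (hT : 0 < T) (hα : 0 < α)
    (hL : Martingale L 𝓕 P) (hc : ∀ ω, IsCadlag fun t => L t ω) :
    bmoNorm P 𝓕 2 (fun t ω => riemannLiouville α (fun s => L s ω) t) ≤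
      ENNReal.ofReal (2 * (√(2 * α) / T ^ α)) * besovNorm P α ∞ 2 L := by
  have hTα := Real.rpow_pos_of_pos hT α
  by_cases hB : besovNorm P α ∞ 2 L = ∞
  · rw [hB, ENNReal.mul_top (ENNReal.ofReal_pos.2 (by positivity)).ne']
    exact le_top
  have hne := ENNReal.mul_ne_top
    (ENNReal.ofReal_ne_top (r := 2 * (√(2 * α) / T ^ α))) hB
  refine (iInf₂_le _ fun t ρ hρ hρt => ?_).trans_eq (ENNReal.coe_toNNReal hne)
  rw [ENNReal.coe_toNNReal hne]
  simpa only [ENNReal.rpow_ofNat] using ae_condLExp_riemannLiouville_le hT hα hL hc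
    (eLpNorm_ne_top_of_besovNorm_two_ne_top hL hB t) hρ hρt

end RLBesov

theorem mainTheorem4 {Ω : Type*} [MeasurableSpace Ω] (P : Measure Ω) [IsProbabilityMeasure P]
    (T : ℝ) (hT : 0 < T) (𝓕 : Filtration (Set.Ico (0 : ℝ) T) ‹MeasurableSpace Ω›)
    (α : ℝ) (hα : 0 < α) (L : Set.Ico (0 : ℝ) T → Ω → ℝ) (hL : Martingale L 𝓕 P)
    (hcadlag : ∀ ω, RLBesov.IsCadlag fun t => L t ω) :
    (eLpNorm (fun ω => ⨆ t, ‖RLBesov.riemannLiouville α (fun s => L s ω) t‖ₑ) ∞ P ≤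
        ENNReal.ofReal (α / T ^ α) * RLBesov.besovNorm P α ∞ 1 L) ∧
    ((∀ ω, L ⟨0, le_rfl, hT⟩ ω = 0) →
      RLBesov.bmoNorm P 𝓕 2 (fun t ω => RLBesov.riemannLiouville α (fun s => L s ω) t) ≤
        ENNReal.ofReal (3 * (√(2 * α) / T ^ α)) * RLBesov.besovNorm P α ∞ 2 L) ∧
    (∀ t : Set.Ico (0 : ℝ) T,
      eLpNorm (L t) ∞ P ≤
        ENNReal.ofReal (1 / (T - (t : ℝ)) ^ α) * RLBesov.besovNorm P α ∞ ∞ L) := by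
  refine ⟨RLBesov.eLpNorm_iSup_riemannLiouville_le hT hα hL hcadlag, fun _ => ?_,
    RLBesov.eLpNorm_le_besovNorm_top hα hL⟩
  refine (RLBesov.bmoNorm_riemannLiouville_le hT hα hL hcadlag).trans ?_
  gcongr
  norm_num
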